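/- Let $T=\sum_{j=0}^k Q_j(x)\frac{d^j}{dx^j}$, with $k\ge 1$, $Q_j\in\mathbb{C}[x]$ and $Q_k\not\equiv 0$, be a differential operator that is non-degenerate, i.e. $\max_{0\le j\le k}(\deg Q_j-j)=\deg Q_k-k$ (with $\deg 0=-\infty$). A closed set $S\subseteq\mathbb{C}$ is called $T_n$-invariant (resp. $T_{\ge n}$-invariant) if for every polynomial $p\neq 0$ of degree exactly $n$ (resp. at least $n$) with all roots in $S$, the polynomial $T(p)$ is either $0$ or has all its roots in $S$. A nonempty $T_{\ge n}$-invariant set is called minimal if none of its nonempty proper subsets is $T_{\ge n}$-invariant. (1) There are an integer $N_0\ge 0$ and a real number $R_0>0$ such that for all $n\ge N_0$ and all $R\ge R_0$ the closed disk $\{x:|x|\le R\}$ is $T_n$-invariant; moreover, for every polynomial $p$ of degree $n$ with all roots in the open disk $\{x:|x|<R\}$, the polynomial $T(p)$ is either $0$ or has all its roots in that open disk. (2) There is an integer $N_1\ge 0$ such that for every $n\ge N_1$ every minimal $T_{\ge n}$-invariant set is compact, and, if $Q_k$ is non-constant, there is exactly one minimal $T_{\ge n}$-invariant set. In particular, if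 $Q_k$ is non-constant, the unique minimal $T_{\ge n}$-invariant set $M_{\ge n}$ exists and is compact for all sufficiently large $n$. -/

import Mathlib

open Polynomial

noncomputable section

/-- The differential operator `T = ∑_{j=0}^k Q_j(x) (d/dx)^j` acting on `ℂ[x]`. -/
def diffOp {k : ℕ} (Q : Fin (k + 1) → ℂ[X]) : ℂ[X] →ₗ[ℂ] ℂ[X] :=
  ∑ j : Fin (k + 1), LinearMap.mulLeft ℂ (Q j) ∘ₗ (derivative ^ (j : ℕ))

theorem diffOp_apply {k : ℕ} (Q : Fin (k + 1) → ℂ[X]) (p : ℂ[X]) :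
    diffOp Q p = ∑ j : Fin (k + 1), Q j * derivative^[(j : ℕ)] p := by
  simp [diffOp, LinearMap.sum_apply, Module.End.pow_apply]

/-- `deg Q - j`, with the convention `deg 0 = -∞` (that is, `⊥`). -/
def shiftedDegree (q : ℂ[X]) (j : ℕ) : WithBot ℤ :=
  q.degree.map fun d : ℕ => (d : ℤ) - (j : ℤ)

/-- The Fuchs index `max_{0 ≤ j ≤ k} (deg Q_j - j)`. -/
def fuchsIndex {k : ℕ} (Q : Fin (k + 1) → ℂ[X]) : WithBot ℤ :=
  Finset.univ.sup fun j : Fin (k + 1) => shiftedDegree (Q j) j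

/-- The operator is non-degenerate: the Fuchs index is realized by the leading coefficient `Q_k`. -/
def IsNonDegenerate {k : ℕ} (Q : Fin (k + 1) → ℂ[X]) : Prop :=
  fuchsIndex Q = shiftedDegree (Q (Fin.last k)) k

/-- All complex roots of `p` lie in `S`. -/
def RootsIn (p : ℂ[X]) (S : Set ℂ) : Prop :=
  ∀ z : ℂ, p.IsRoot z → z ∈ S

/-- Every polynomial of degree exactly `n` with all roots in `S` is sent by `T` to `0` or to a
polynomial with all roots in `S`. -/
def PreservesRootsDeg (T : ℂ[X] →ₗ[ℂ] ℂ[X]) (n : ℕ) (S : Set ℂ) : Prop :=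
  ∀ p : ℂ[X], p.degree = (n : WithBot ℕ) → RootsIn p S → T p = 0 ∨ RootsIn (T p) S

/-- `S` is `T_n`-invariant. -/
def IsInvariantDeg (T : ℂ[X] →ₗ[ℂ] ℂ[X]) (n : ℕ) (S : Set ℂ) : Prop :=
  IsClosed S ∧ PreservesRootsDeg T n S

/-- `S` is `T_{≥ n}`-invariant: `S` is closed, and every polynomial of degree at least `n` with
all roots in `S` is sent by `T` to `0` or to a polynomial with all roots in `S`. -/
def IsInvariantGE (T : ℂ[X] →ₗ[ℂ] ℂ[X]) (n : ℕ) (S : Set ℂ) : Prop :=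
  IsClosed S ∧
    ∀ p : ℂ[X], (n : WithBot ℕ) ≤ p.degree → RootsIn p S → T p = 0 ∨ RootsIn (T p) S

/-- `M` is a minimal `T_{≥ n}`-invariant set: it is nonempty and `T_{≥ n}`-invariant, and no
nonempty proper subset of it is `T_{≥ n}`-invariant. -/
def IsMinimalInvariantGE (T : ℂ[X] →ₗ[ℂ] ℂ[X]) (n : ℕ) (M : Set ℂ) : Prop :=
  M.Nonempty ∧ IsInvariantGE T n M ∧
    ∀ S : Set ℂ, S ⊂ M → S.Nonempty → ¬ IsInvariantGE T n S

end

open Filter Topology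

/-!
The proof rests on two facts about an operator `T = ∑ Q_j (d/dx)^j` that is non-degenerate, which
means that `deg (Q_j · (x - a)^(k-j)) ≤ deg Q_k` for every `j` and `a`.

*Large disks are invariant.* Let `p` of degree `n` have all its roots in the open disk of radius
`|x|`. Every root `w` satisfies `Re (x / (x - w)) ≥ 1/2`, so the logarithmic derivative of `p` gives
`n |p(x)| ≤ 2 |x| |p'(x)|`. By Gauss–Lucas the same applies to the derivatives of `p`, whence
`(n - k)^(k-j) |p^(j)(x)| ≤ (2 |x|)^(k-j) |p^(k)(x)|`
(`Polynomial.pow_mul_norm_eval_le_iterate_derivative`). For large `|x|` non-degeneracy bounds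
`|Q_j(x)| |x|^(k-j)` by a constant multiple of `|Q_k(x)|`, so for large `n` the term of order `k`
dominates all others together and `T p` does not vanish at `x` (`exists_diffOp_eval_ne_zero`).
As an intersection of invariant sets is invariant, a minimal invariant set lies in each large disk
that it meets, so it is compact.

*Invariant sets contain the roots of `Q_k`.* If `a` lies in the invariant set `S`, apply `T` to
`(x - a)^m`. The result is `m(m-1)⋯(m-k+1) (x - a)^(m-k) F_m`, where `F_m` tends to `Q_k`
coefficientwise as `m → ∞`. The roots of `F_m` lie in the closed set `S`, and they
accumulate at every root of `Q_k` (`root_mem_of_isInvariantGE`). If `Q_k` is non-constant, the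
intersection of all nonempty invariant sets is therefore nonempty, and it is the unique minimal one.
-/

/-! ### Growth of derivatives outside a disk containing the roots -/

theorem Complex.half_le_re_div_sub {x w : ℂ} (h : ‖w‖ < ‖x‖) : 1 / 2 ≤ (x / (x - w)).re := by
  have hne : x - w ≠ 0 := by
    rw [sub_ne_zero]
    rintro rfl
    exact lt_irrefl _ h
  have hpos : 0 < Complex.normSq (x - w) := Complex.normSq_pos.2 hne
  have h2 : Complex.normSq w < Complex.normSq x := by
    rw [Complex.normSq_eq_norm_sq, Complex.normSq_eq_norm_sq]
    gcongr
  rw [Complex.div_re, ← add_div, le_div_iff₀ hpos]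
  simp only [Complex.normSq_apply, Complex.sub_re, Complex.sub_im] at *
  nlinarith

namespace Polynomial

theorem natDegree_mul_norm_eval_le_derivative {p : ℂ[X]} {x : ℂ}
    (h : RootsIn p (Metric.ball 0 ‖x‖)) :
    p.natDegree * ‖p.eval x‖ ≤ 2 * ‖x‖ * ‖(derivative p).eval x‖ := by
  by_cases hx : p.eval x = 0
  · rw [hx, norm_zero, mul_zero]
    positivity
  have hp : p ≠ 0 := by
    rintro rfl
    simp at hx
  have hs : p.Splits := IsAlgClosed.splits p
  have key : x * (derivative p).eval x
      = p.eval x * (p.roots.map fun w => x / (x - w)).sum := by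
    rw [hs.eval_derivative_eq_eval_mul_sum hx, mul_left_comm, ← Multiset.sum_map_mul_left]
    simp only [mul_one_div]
  have hsum : (p.natDegree : ℝ) * (1 / 2) ≤ (p.roots.map fun w => x / (x - w)).sum.re := by
    have h1 : (p.roots.map fun w => x / (x - w)).sum.re
        = (p.roots.map fun w => (x / (x - w)).re).sum := by
      rw [← Complex.coe_reAddGroupHom, map_multiset_sum, Multiset.map_map]
      rfl
    rw [h1, hs.natDegree_eq_card_roots, ← nsmul_eq_mul]
    have h2 := Multiset.card_nsmul_le_sum (s := p.roots.map fun w => (x / (x - w)).re)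
      (a := (1 / 2 : ℝ)) ?_
    · simpa using h2
    · intro y hy
      obtain ⟨w, hw, rfl⟩ := Multiset.mem_map.1 hy
      have := h w ((mem_roots hp).1 hw)
      exact Complex.half_le_re_div_sub (by simpa using this)
  have h3 := hsum.trans (Complex.re_le_norm _)
  have h4 : ‖x‖ * ‖(derivative p).eval x‖
      = ‖p.eval x‖ * ‖(p.roots.map fun w => x / (x - w)).sum‖ := by
    rw [← norm_mul, key, norm_mul]
  have h5 := mul_le_mul_of_nonneg_left h3 (norm_nonneg (p.eval x))
  linarith

theorem rootsIn_derivative {p : ℂ[X]} {S : Set ℂ} (hS : Convex ℝ S) (hd : 0 < p.natDegree)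
    (h : RootsIn p S) : RootsIn (derivative p) S := by
  intro z hz
  have hdeg : 0 < p.degree := natDegree_pos_iff_degree_pos.1 hd
  have hp : p ≠ 0 := by
    rintro rfl
    simp at hd
  have hp' : derivative p ≠ 0 := fun h0 => by
    have := derivative_eq_zero.1 h0
    omega
  refine convexHull_min ?_ hS (rootSet_derivative_subset_convexHull_rootSet hdeg
    ((mem_rootSet_of_ne hp').2 (by simpa using hz)))
  intro w hw
  exact h w (by simpa using (mem_rootSet_of_ne hp).1 hw)

theorem natDegree_iterate_derivative_eq (p : ℂ[X]) (j : ℕ) :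
    (derivative^[j] p).natDegree = p.natDegree - j := by
  induction j with
  | zero => rfl
  | succ j ih => rw [Function.iterate_succ_apply', natDegree_derivative, ih, Nat.sub_sub]

theorem rootsIn_iterate_derivative {p : ℂ[X]} {S : Set ℂ} (hS : Convex ℝ S) (h : RootsIn p S)
    {j : ℕ} (hj : j ≤ p.natDegree) : RootsIn (derivative^[j] p) S := by
  induction j with
  | zero => exact h
  | succ j ih =>
    rw [Function.iterate_succ_apply']
    refine rootsIn_derivative hS ?_ (ih (by omega))
    rw [natDegree_iterate_derivative_eq]
    omega

/-- Outside a disk that contains the roots of `p`, the `i`-th derivative of `p` is larger than `p`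
by a factor of order `(deg p / |x|)^i`. -/
theorem pow_mul_norm_eval_le_iterate_derivative {x : ℂ} (i : ℕ) {p : ℂ[X]}
    (h : RootsIn p (Metric.ball 0 ‖x‖)) (hi : i ≤ p.natDegree) :
    ((p.natDegree - i : ℕ) : ℝ) ^ i * ‖p.eval x‖ ≤
      (2 * ‖x‖) ^ i * ‖(derivative^[i] p).eval x‖ := by
  induction i generalizing p with
  | zero => simp
  | succ i ih =>
    have hd : (derivative p).natDegree = p.natDegree - 1 := natDegree_derivative p
    have h1 := ih (rootsIn_derivative (convex_ball 0 _) (by omega) h) (by omega)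
    rw [hd, show p.natDegree - 1 - i = p.natDegree - (i + 1) by omega] at h1
    set L : ℝ := ((p.natDegree - (i + 1) : ℕ) : ℝ) with hL
    have hL0 : 0 ≤ L := Nat.cast_nonneg _
    have hL1 : L ≤ p.natDegree := by
      rw [hL]
      exact_mod_cast Nat.sub_le _ _
    have h2 := natDegree_mul_norm_eval_le_derivative h
    rw [Function.iterate_succ_apply]
    calc L ^ (i + 1) * ‖p.eval x‖ = L ^ i * (L * ‖p.eval x‖) := by ring
      _ ≤ L ^ i * (p.natDegree * ‖p.eval x‖) := by gcongr
      _ ≤ L ^ i * (2 * ‖x‖ * ‖(derivative p).eval x‖) := by gcongr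
      _ = 2 * ‖x‖ * (L ^ i * ‖(derivative p).eval x‖) := by ring
      _ ≤ 2 * ‖x‖ * ((2 * ‖x‖) ^ i * ‖(derivative^[i] (derivative p)).eval x‖) := by gcongr
      _ = _ := by ring

end Polynomial

/-! ### Invariance of large disks -/

theorem IsNonDegenerate.degree_mul_le {k : ℕ} {Q : Fin (k + 1) → ℂ[X]} (hT : IsNonDegenerate Q)
    (hQ : Q (Fin.last k) ≠ 0) (j : Fin (k + 1)) (a : ℂ) :
    (Q j * (X - C a) ^ (k - (j : ℕ))).degree ≤ (Q (Fin.last k)).degree := by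
  by_cases h0 : Q j = 0
  · simp [h0]
  have h1 : shiftedDegree (Q j) j ≤ shiftedDegree (Q (Fin.last k)) k := by
    rw [← hT]
    exact Finset.le_sup (f := fun j : Fin (k + 1) => shiftedDegree (Q j) j) (Finset.mem_univ j)
  have h2 : ((Q j).natDegree : ℤ) - j ≤ (Q (Fin.last k)).natDegree - k := by
    rw [shiftedDegree, shiftedDegree, degree_eq_natDegree h0, degree_eq_natDegree hQ] at h1
    exact WithBot.coe_le_coe.1 h1
  have hj := j.is_le
  rw [degree_mul, degree_pow, degree_X_sub_C, degree_eq_natDegree h0, degree_eq_natDegree hQ,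
    nsmul_one]
  have h3 : (Q j).natDegree + (k - (j : ℕ)) ≤ (Q (Fin.last k)).natDegree := by omega
  exact_mod_cast h3

theorem exists_norm_eval_mul_pow_le {k : ℕ} {Q : Fin (k + 1) → ℂ[X]} (hT : IsNonDegenerate Q)
    (hQ : Q (Fin.last k) ≠ 0) :
    ∃ B R₀ : ℝ, 0 < B ∧ 0 < R₀ ∧ ∀ x : ℂ, R₀ ≤ ‖x‖ → (Q (Fin.last k)).eval x ≠ 0 ∧
      ∀ j : Fin (k + 1), ‖(Q j).eval x‖ * ‖x‖ ^ (k - (j : ℕ)) ≤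
        B * ‖(Q (Fin.last k)).eval x‖ := by
  have hO : ∀ j : Fin (k + 1), ∃ B : ℝ, ∀ᶠ x in Bornology.cobounded ℂ,
      ‖(Q j).eval x‖ * ‖x‖ ^ (k - (j : ℕ)) ≤ B * ‖(Q (Fin.last k)).eval x‖ := by
    intro j
    obtain ⟨B, hB⟩ :=
      (Polynomial.isBigO_cobounded_of_degree_le (hT.degree_mul_le hQ j 0)).bound
    exact ⟨B, hB.mono fun x hx => by simpa using hx⟩
  choose B hB using hO
  have hroot : ∀ᶠ x in Bornology.cobounded ℂ, (Q (Fin.last k)).eval x ≠ 0 :=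
    (eventually_cofinite_not_isRoot hQ).filter_mono (Bornology.le_cofinite ℂ)
  obtain ⟨R, -, hR⟩ := (hasBasis_cobounded_norm (E := ℂ)).eventually_iff.1
    (hroot.and (eventually_all.2 hB))
  refine ⟨∑ j, |B j| + 1, max R 1, by positivity, by positivity, fun x hx => ?_⟩
  obtain ⟨h1, h2⟩ := hR (show R ≤ ‖x‖ from (le_max_left _ _).trans hx)
  refine ⟨h1, fun j => (h2 j).trans ?_⟩
  gcongr
  calc B j ≤ |B j| := le_abs_self _
    _ ≤ ∑ j, |B j| :=
      Finset.single_le_sum (f := fun j => |B j|) (fun i _ => abs_nonneg _) (Finset.mem_univ j)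
    _ ≤ _ := by linarith

/-- If all roots of `p` are closer to the origin than `x`, then `T p` does not vanish at `x`,
provided that `deg p` and `|x|` are large. The two bounds are independent of each other. -/
theorem exists_diffOp_eval_ne_zero {k : ℕ} {Q : Fin (k + 1) → ℂ[X]} (hT : IsNonDegenerate Q)
    (hQ : Q (Fin.last k) ≠ 0) :
    ∃ (N₀ : ℕ) (R₀ : ℝ), 0 < R₀ ∧ ∀ (p : ℂ[X]) (x : ℂ), N₀ ≤ p.natDegree → R₀ ≤ ‖x‖ →
      RootsIn p (Metric.ball 0 ‖x‖) → (diffOp Q p).eval x ≠ 0 := by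
  obtain ⟨B, R₀, hB, hR₀, hbound⟩ := exists_norm_eval_mul_pow_le hT hQ
  obtain ⟨M, hM⟩ := exists_nat_gt (2 * k * B + 2)
  refine ⟨k + M, R₀, hR₀, fun p x hn hx hp => ?_⟩
  obtain ⟨hq, hj⟩ := hbound x hx
  have hxpos : 0 < ‖x‖ := hR₀.trans_le hx
  set L : ℝ := ((p.natDegree - k : ℕ) : ℝ) with hL
  have hML : (M : ℝ) ≤ L := by
    rw [hL]
    exact_mod_cast (by omega : M ≤ p.natDegree - k)
  have hkB : 0 ≤ 2 * k * B := by positivity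
  have hL2 : 2 < L := by linarith
  have hL0 : 0 < L := by linarith
  have hballs : ∀ j ≤ k, RootsIn (derivative^[j] p) (Metric.ball 0 ‖x‖) := fun j hjk =>
    Polynomial.rootsIn_iterate_derivative (convex_ball 0 _) hp (by omega)
  have hderiv : ∀ j ≤ k, L ^ (k - j) * ‖(derivative^[j] p).eval x‖ ≤
      (2 * ‖x‖) ^ (k - j) * ‖(derivative^[k] p).eval x‖ := by
    intro j hjk
    have hnd := Polynomial.natDegree_iterate_derivative_eq p j
    have := Polynomial.pow_mul_norm_eval_le_iterate_derivative (k - j) (hballs j hjk) (by omega)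
    rwa [← Function.iterate_add_apply, Nat.sub_add_cancel hjk, hnd,
      show p.natDegree - j - (k - j) = p.natDegree - k by omega] at this
  set W : ℝ := ‖(Q (Fin.last k)).eval x‖ * ‖(derivative^[k] p).eval x‖ with hW
  have hWpos : 0 < W := by
    refine mul_pos (norm_pos_iff.2 hq) (norm_pos_iff.2 fun h0 => ?_)
    -- A zero of `p^(k)` at `x` would lie in the open disk of radius `‖x‖`, by Gauss–Lucas.
    have := hballs k le_rfl x h0
    simp at this
  have hterm : ∀ j : Fin k,
      ‖(Q j.castSucc * derivative^[(j : ℕ)] p).eval x‖ ≤ B * (2 / L) * W := by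
    intro j
    have h1 := hj j.castSucc
    have h2 := hderiv j j.is_lt.le
    rw [Fin.val_castSucc] at h1
    have hi : k - (j : ℕ) ≠ 0 := by have := j.is_lt; omega
    generalize k - (j : ℕ) = i at h1 h2 hi
    have h3 : ‖(derivative^[(j : ℕ)] p).eval x‖ ≤
        (2 * ‖x‖) ^ i * ‖(derivative^[k] p).eval x‖ / L ^ i := by
      rw [le_div_iff₀ (by positivity), mul_comm]
      exact h2
    have h4 : (2 / L) ^ i ≤ 2 / L :=
      pow_le_of_le_one (by positivity) ((div_le_one hL0).2 hL2.le) hi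
    rw [eval_mul, norm_mul]
    calc ‖(Q j.castSucc).eval x‖ * ‖(derivative^[(j : ℕ)] p).eval x‖
        ≤ ‖(Q j.castSucc).eval x‖ *
            ((2 * ‖x‖) ^ i * ‖(derivative^[k] p).eval x‖ / L ^ i) := by gcongr
      _ = (‖(Q j.castSucc).eval x‖ * ‖x‖ ^ i) * ((2 / L) ^ i * ‖(derivative^[k] p).eval x‖) := by
        rw [mul_pow, div_pow]
        ring
      _ ≤ (B * ‖(Q (Fin.last k)).eval x‖) * (2 / L * ‖(derivative^[k] p).eval x‖) := by gcongr
      _ = _ := by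
        rw [hW]
        ring
  intro h0
  rw [diffOp_apply, eval_finsetSum, Fin.sum_univ_castSucc] at h0
  have h1 := norm_sum_le Finset.univ
    fun j : Fin k => (Q j.castSucc * derivative^[(j : ℕ)] p).eval x
  have h2 := h1.trans (Finset.sum_le_sum fun j _ => hterm j)
  have h3 : ‖∑ j : Fin k, (Q j.castSucc * derivative^[(j : ℕ)] p).eval x‖ = W := by
    have := eq_neg_of_add_eq_zero_left h0
    simp only [Fin.val_castSucc, Fin.val_last] at this
    rw [this, norm_neg, eval_mul, norm_mul]
  rw [h3, Finset.sum_const, Finset.card_univ, Fintype.card_fin, nsmul_eq_mul] at h2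
  have h4 : (k : ℝ) * (B * (2 / L) * W) = (2 * k * B / L) * W := by ring
  have h5 : 2 * k * B / L < 1 := (div_lt_one hL0).2 (by linarith)
  nlinarith

/-- The nonvanishing result is applied at a point `z` outside the disk, with the radius `‖z‖`; this
covers the closed and the open disk alike. -/
theorem exists_disks_invariant {k : ℕ} {Q : Fin (k + 1) → ℂ[X]} (hT : IsNonDegenerate Q)
    (hQ : Q (Fin.last k) ≠ 0) :
    ∃ N₀ : ℕ, ∃ R₀ : ℝ, 0 < R₀ ∧ ∀ n : ℕ, N₀ ≤ n → ∀ R : ℝ, R₀ ≤ R →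
      IsInvariantDeg (diffOp Q) n (Metric.closedBall (0 : ℂ) R) ∧
      PreservesRootsDeg (diffOp Q) n (Metric.ball (0 : ℂ) R) := by
  obtain ⟨N₀, R₀, hR₀, h⟩ := exists_diffOp_eval_ne_zero hT hQ
  refine ⟨N₀, R₀, hR₀, fun n hn R hR => ⟨⟨Metric.isClosed_closedBall, ?_⟩, ?_⟩⟩
  · refine fun p hp hroots => Or.inr fun z hz => ?_
    by_contra hzR
    rw [mem_closedBall_zero_iff, not_le] at hzR
    refine h p z (by rwa [natDegree_eq_of_degree_eq_some hp]) (hR.trans hzR.le) ?_ hz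
    exact fun w hw => Metric.closedBall_subset_ball hzR (hroots w hw)
  · refine fun p hp hroots => Or.inr fun z hz => ?_
    by_contra hzR
    rw [mem_ball_zero_iff, not_lt] at hzR
    refine h p z (by rwa [natDegree_eq_of_degree_eq_some hp]) (hR.trans hzR) ?_ hz
    exact fun w hw => Metric.ball_subset_ball hzR (hroots w hw)

/-! ### Invariant sets contain the roots of the leading coefficient -/

theorem tendsto_descFactorial_div {j k : ℕ} (h : j < k) :
    Tendsto (fun m : ℕ => (m.descFactorial j : ℂ) / m.descFactorial k) atTop (𝓝 0) := by
  have hlim : Tendsto (fun m : ℕ => (1 : ℝ) / ((m - j : ℕ) : ℝ)) atTop (𝓝 0) :=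
    tendsto_one_div_atTop_nhds_zero_nat.comp (tendsto_sub_atTop_nat j)
  refine squeeze_zero_norm' ?_ hlim
  filter_upwards [eventually_ge_atTop k] with m hm
  have hpos : 0 < m.descFactorial k := Nat.descFactorial_pos.2 hm
  have hle : ∀ i, j + 1 + i ≤ k → m.descFactorial (j + 1) ≤ m.descFactorial (j + 1 + i) := by
    intro i
    induction i with
    | zero => exact fun _ => le_rfl
    | succ i ih =>
      intro hi
      refine (ih (by omega)).trans ?_
      rw [← add_assoc, Nat.descFactorial_succ]
      exact Nat.le_mul_of_pos_left _ (by omega)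
  have h1 := hle (k - (j + 1)) (by omega)
  rw [show j + 1 + (k - (j + 1)) = k by omega, Nat.descFactorial_succ] at h1
  have hmj : (0 : ℝ) < ((m - j : ℕ) : ℝ) := by exact_mod_cast (by omega : 0 < m - j)
  rw [norm_div, Complex.norm_natCast, Complex.norm_natCast,
    div_le_div_iff₀ (by exact_mod_cast hpos) hmj, one_mul, mul_comm]
  exact_mod_cast h1

/-- The cofactor of `m(m-1)⋯(m-k+1) (x - a)^(m-k)` in `T ((x - a)^m)`. -/
noncomputable def powerCofactor {k : ℕ} (Q : Fin (k + 1) → ℂ[X]) (a : ℂ) (m : ℕ) : ℂ[X] :=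
  ∑ j : Fin (k + 1), C ((m.descFactorial j : ℂ) / m.descFactorial k) *
    (Q j * (X - C a) ^ (k - (j : ℕ)))

theorem diffOp_X_sub_C_pow {k : ℕ} (Q : Fin (k + 1) → ℂ[X]) (a : ℂ) {m : ℕ} (hm : k ≤ m) :
    diffOp Q ((X - C a) ^ m) =
      C (m.descFactorial k : ℂ) * (X - C a) ^ (m - k) * powerCofactor Q a m := by
  rw [diffOp_apply, powerCofactor, Finset.mul_sum]
  refine Finset.sum_congr rfl fun j _ => ?_
  have hj := j.is_le
  have hpos : (m.descFactorial k : ℂ) ≠ 0 := by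
    exact_mod_cast (Nat.descFactorial_pos.2 hm).ne'
  rw [iterate_derivative_X_sub_pow, nsmul_eq_mul, show m - (j : ℕ) = (m - k) + (k - j) by omega,
    pow_add, ← C_eq_natCast]
  have hC : (C (m.descFactorial j : ℂ) : ℂ[X]) =
      C (m.descFactorial k : ℂ) * C ((m.descFactorial j : ℂ) / m.descFactorial k) := by
    rw [← C_mul, mul_div_cancel₀ _ hpos]
  rw [show ((m.descFactorial j : ℕ) : ℂ) = (m.descFactorial j : ℂ) from rfl, hC]
  ring

/-- Coefficientwise and pointwise convergence of the cofactors to `Q_k`, expressed at once through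
an arbitrary linear functional. -/
theorem tendsto_map_powerCofactor {k : ℕ} (Q : Fin (k + 1) → ℂ[X]) (a : ℂ) (φ : ℂ[X] →ₗ[ℂ] ℂ) :
    Tendsto (fun m => φ (powerCofactor Q a m)) atTop (𝓝 (φ (Q (Fin.last k)))) := by
  have hsum : ∀ m, φ (powerCofactor Q a m) = ∑ j : Fin (k + 1),
      (m.descFactorial j : ℂ) / m.descFactorial k * φ (Q j * (X - C a) ^ (k - (j : ℕ))) := by
    intro m
    simp only [powerCofactor, map_sum, ← smul_eq_C_mul, map_smul, smul_eq_mul]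
  have hval : φ (Q (Fin.last k)) = ∑ j : Fin (k + 1),
      (if j = Fin.last k then (1 : ℂ) else 0) * φ (Q j * (X - C a) ^ (k - (j : ℕ))) := by
    simp
  simp only [hsum]
  rw [hval]
  refine tendsto_finsetSum _ fun j _ => Tendsto.mul_const _ ?_
  split_ifs with hj
  · subst hj
    refine tendsto_const_nhds.congr' ?_
    filter_upwards [eventually_ge_atTop k] with m hm
    have hpos : (m.descFactorial k : ℂ) ≠ 0 := by
      exact_mod_cast (Nat.descFactorial_pos.2 hm).ne'
    simp [div_self hpos]
  · exact tendsto_descFactorial_div (by simpa [Fin.lt_def] using Fin.lt_last_iff_ne_last.2 hj)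

theorem Polynomial.norm_leadingCoeff_mul_pow_le_norm_eval {f : ℂ[X]} {b : ℂ} {ε : ℝ} (hε : 0 ≤ ε)
    (hf : f ≠ 0) (h : ∀ w, f.IsRoot w → ε ≤ ‖b - w‖) :
    ‖f.leadingCoeff‖ * ε ^ f.natDegree ≤ ‖f.eval b‖ := by
  have hs : f.Splits := IsAlgClosed.splits f
  rw [hs.eval_eq_prod_roots, norm_mul]
  refine mul_le_mul_of_nonneg_left ?_ (norm_nonneg _)
  rw [hs.natDegree_eq_card_roots, show ∀ s : Multiset ℂ, ‖s.prod‖ = (s.map norm).prod from map_multiset_prod (normHom (α := ℂ)), Multiset.map_map, ← Multiset.prod_replicate,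
    ← Multiset.map_const']
  exact Multiset.prod_map_le_prod_map₀ _ _ (fun _ _ => hε) fun w hw => h w ((mem_roots hf).1 hw)

/-- A nonempty invariant set contains all roots of the leading coefficient `Q_k`: otherwise the
roots of the cofactors of `T ((x - a)^m)` would avoid a neighbourhood of a root of their limit. -/
theorem root_mem_of_isInvariantGE {k : ℕ} {Q : Fin (k + 1) → ℂ[X]} (hT : IsNonDegenerate Q)
    (hQ : Q (Fin.last k) ≠ 0) {n : ℕ} {S : Set ℂ} (hS : IsInvariantGE (diffOp Q) n S)
    (hne : S.Nonempty) {b : ℂ} (hb : (Q (Fin.last k)).IsRoot b) : b ∈ S := by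
  obtain ⟨a, ha⟩ := hne
  by_contra hbS
  obtain ⟨ε, hε, hball⟩ := Metric.isOpen_iff.1 hS.1.isOpen_compl b hbS
  set d := (Q (Fin.last k)).natDegree with hd
  have hnat : ∀ m, (powerCofactor Q a m).natDegree ≤ d := by
    refine fun m => natDegree_le_natDegree ?_
    refine (degree_sum_le _ _).trans (Finset.sup_le fun j _ => ?_)
    rw [← smul_eq_C_mul]
    exact (degree_smul_le _ _).trans (hT.degree_mul_le hQ j a)
  have hcoeff := tendsto_map_powerCofactor Q a (lcoeff ℂ d)
  have heval := tendsto_map_powerCofactor Q a (leval b)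
  simp only [lcoeff_apply, leval_apply] at hcoeff heval
  rw [hb.eq_zero] at heval
  have hlc : (Q (Fin.last k)).coeff d ≠ 0 := leadingCoeff_ne_zero.2 hQ
  have hev : ∀ᶠ m in atTop,
      ‖(powerCofactor Q a m).coeff d‖ * ε ^ d ≤ ‖(powerCofactor Q a m).eval b‖ := by
    filter_upwards [hcoeff.eventually_ne hlc, eventually_ge_atTop k, eventually_ge_atTop n]
      with m hm0 hmk hmn
    have hdm : (powerCofactor Q a m).natDegree = d :=
      le_antisymm (hnat m) (le_natDegree_of_ne_zero hm0)
    have hF : powerCofactor Q a m ≠ 0 := by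
      intro h0
      simp [h0] at hm0
    have hTp : diffOp Q ((X - C a) ^ m) ≠ 0 := by
      rw [diffOp_X_sub_C_pow Q a hmk]
      refine mul_ne_zero (mul_ne_zero ?_ (pow_ne_zero _ (X_sub_C_ne_zero a))) hF
      rw [Ne, C_eq_zero]
      exact_mod_cast (Nat.descFactorial_pos.2 hmk).ne'
    have hroots : RootsIn (diffOp Q ((X - C a) ^ m)) S := by
      refine (hS.2 ((X - C a) ^ m) ?_ fun z hz => ?_).resolve_left hTp
      · rw [degree_pow, degree_X_sub_C, nsmul_one]
        exact_mod_cast hmn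
      · have hz' : (z - a) ^ m = 0 := by simpa using hz
        rw [sub_eq_zero.1 (eq_zero_of_pow_eq_zero hz')]
        exact ha
    rw [← hdm]
    refine Polynomial.norm_leadingCoeff_mul_pow_le_norm_eval hε.le hF fun w hw => ?_
    by_contra hlt
    refine hball (a := w) ?_ (hroots w ?_)
    · rw [Metric.mem_ball, dist_comm, dist_eq_norm]
      exact not_le.1 hlt
    · rw [diffOp_X_sub_C_pow Q a hmk, IsRoot.def, eval_mul, hw.eq_zero, mul_zero]
  have hlim := le_of_tendsto_of_tendsto (hcoeff.norm.mul_const (ε ^ d)) heval.norm hev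
  rw [norm_zero] at hlim
  exact absurd hlim (not_le.2 (mul_pos (norm_pos_iff.2 hlc) (pow_pos hε d)))

/-! ### Minimal invariant sets -/

theorem IsInvariantGE.sInter {T : ℂ[X] →ₗ[ℂ] ℂ[X]} {n : ℕ} {𝒮 : Set (Set ℂ)}
    (h : ∀ S ∈ 𝒮, IsInvariantGE T n S) : IsInvariantGE T n (⋂₀ 𝒮) := by
  refine ⟨isClosed_sInter fun S hS => (h S hS).1, fun p hp hroots => ?_⟩
  by_cases h0 : T p = 0
  · exact Or.inl h0
  · exact Or.inr fun z hz S hS =>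
      ((h S hS).2 p hp fun w hw => hroots w hw S hS).resolve_left h0 z hz

theorem IsInvariantGE.inter {T : ℂ[X] →ₗ[ℂ] ℂ[X]} {n : ℕ} {S S' : Set ℂ}
    (h : IsInvariantGE T n S) (h' : IsInvariantGE T n S') : IsInvariantGE T n (S ∩ S') := by
  rw [← Set.sInter_pair]
  exact IsInvariantGE.sInter (by rintro _ (rfl | rfl) <;> assumption)

theorem isInvariantGE_of_forall_isInvariantDeg {T : ℂ[X] →ₗ[ℂ] ℂ[X]} {n : ℕ} {S : Set ℂ}
    (h : ∀ m, n ≤ m → IsInvariantDeg T m S) : IsInvariantGE T n S := by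
  refine ⟨(h n le_rfl).1, fun p hp hroots => ?_⟩
  have hp0 : p ≠ 0 := by
    rintro rfl
    simp at hp
  rw [degree_eq_natDegree hp0] at hp
  exact (h p.natDegree (by exact_mod_cast hp)).2 p (degree_eq_natDegree hp0) hroots

theorem IsMinimalInvariantGE.subset {T : ℂ[X] →ₗ[ℂ] ℂ[X]} {n : ℕ} {M S : Set ℂ}
    (hM : IsMinimalInvariantGE T n M) (hS : IsInvariantGE T n S) (hne : (M ∩ S).Nonempty) :
    M ⊆ S := by
  by_contra hMS
  exact hM.2.2 (M ∩ S)
    ⟨Set.inter_subset_left, fun h => hMS (h.trans Set.inter_subset_right)⟩ hne (hM.2.1.inter hS)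

theorem existsUnique_isMinimalInvariantGE {T : ℂ[X] →ₗ[ℂ] ℂ[X]} {n : ℕ} {b : ℂ}
    (hb : ∀ S : Set ℂ, IsInvariantGE T n S → S.Nonempty → b ∈ S) :
    ∃! M : Set ℂ, IsMinimalInvariantGE T n M := by
  have hinv : IsInvariantGE T n (⋂₀ {S | IsInvariantGE T n S ∧ S.Nonempty}) :=
    IsInvariantGE.sInter fun S hS => hS.1
  have hbM : b ∈ ⋂₀ {S | IsInvariantGE T n S ∧ S.Nonempty} := fun S hS => hb S hS.1 hS.2
  refine ⟨_, ⟨⟨b, hbM⟩, hinv, fun S hS hne hSinv => ?_⟩, fun M hM => ?_⟩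
  · exact hS.2 (Set.sInter_subset_of_mem ⟨hSinv, hne⟩)
  · exact (hM.subset hinv ⟨b, hb M hM.2.1 hM.1, hbM⟩).antisymm
      (Set.sInter_subset_of_mem ⟨hM.2.1, hM.1⟩)

theorem mainTheorem5 (k : ℕ) (hk : 1 ≤ k) (Q : Fin (k + 1) → Polynomial ℂ)
    (hQ : Q (Fin.last k) ≠ 0) (hT : IsNonDegenerate Q) :
    (∃ N₀ : ℕ, ∃ R₀ : ℝ, 0 < R₀ ∧ ∀ n : ℕ, N₀ ≤ n → ∀ R : ℝ, R₀ ≤ R →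
      IsInvariantDeg (diffOp Q) n (Metric.closedBall (0 : ℂ) R) ∧
      PreservesRootsDeg (diffOp Q) n (Metric.ball (0 : ℂ) R)) ∧
    (∃ N₁ : ℕ, ∀ n : ℕ, N₁ ≤ n →
      (0 < (Q (Fin.last k)).natDegree → ∃! M : Set ℂ, IsMinimalInvariantGE (diffOp Q) n M) ∧
      ∀ M : Set ℂ, IsMinimalInvariantGE (diffOp Q) n M → IsCompact M) := by
  have hdisks := exists_disks_invariant hT hQ
  refine ⟨hdisks, ?_⟩
  obtain ⟨N₀, R₀, -, hdisk⟩ := hdisks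
  refine ⟨N₀, fun n hn => ⟨fun hdeg => ?_, fun M hM => ?_⟩⟩
  · obtain ⟨b, hb⟩ := IsAlgClosed.exists_root _ (natDegree_pos_iff_degree_pos.1 hdeg).ne'
    exact existsUnique_isMinimalInvariantGE fun S hS hne =>
      root_mem_of_isInvariantGE hT hQ hS hne hb
  · obtain ⟨x, hx⟩ := hM.1
    have hinv : IsInvariantGE (diffOp Q) n (Metric.closedBall 0 (max R₀ ‖x‖)) :=
      isInvariantGE_of_forall_isInvariantDeg fun m hm =>
        (hdisk m (hn.trans hm) _ (le_max_left _ _)).1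
    have hsub := hM.subset hinv ⟨x, hx, by simp⟩
    exact (isCompact_closedBall (0 : ℂ) _).of_isClosed_subset hM.2.1.1 hsub
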